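/- Fix a base $B>1$; all logarithms are to base $B$. For $P>0$ and $n\ge 1$, the $AWGN(P)$ channel at blocklength $n$ has input space $\{x\in\mathbb{R}^n:\|x\|_2\le\sqrt{nP}\}$, output space $\mathbb{R}^n$ and transition kernel $P_{Y^n|X^n=x}=\mathcal{N}(x,I_n)$; its capacity is $C=\tfrac12\log(1+P)$. For $M\ge1$, an $(n,M,\epsilon)_{max,det}$ code consists of a deterministic encoder, assigning to each message $j\in\{1,\dots,M\}$ a codeword in the input space, and a (possibly randomized) decoder, a Markov kernel from $\mathbb{R}^n$ to $\{1,\dots,M\}$, such that for every message $j$ the probability that the decoded message differs from $j$, given that $j$ was sent, is at most $\epsilon$. Write $\|x\|_q=(\sum_{j=1}^n|x_j|^q)^{1/q}$. **Theorem ($q=4$).** Let $0<\epsilon<\tfrac12$ and $P>0$. There exist constants $b_1>0$ and $b_2>0$, depending only on $P$ and $\epsilon$ (and on the fixed base $B$), such that for all $n\ge1$, $M\ge 1$ and every $(n,M,\epsilon)_{max,det}$ code for the $AWGN(P)$ channel, at least half of the $M$ codewords $x$ satisfy $$\|x\|_4^2\le\frac{2}{b_1}\left(nC+b_2\sqrt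 n-\log\frac M2\right).$$ Moreover, there exists a constant $b_3>0$, depending only on $P$ and $\epsilon$ (and on $B$), such that for all $n\ge1$, $M\ge 1$ and every such code, $$\mathbb{E}\big[\|X\|_4^4\big]\ge 3nP^2-\left(nC-\log M+b_3\sqrt n\right)n^{1/4},$$ where $X$ is the codeword of a message chosen uniformly from $\{1,\dots,M\}$. -/

import Mathlib

open MeasureTheory ProbabilityTheory

noncomputable section

/-- A code with `M` messages for the random transformation `W` from `𝒳` to `𝒴`, with a
deterministic encoder, a possibly randomized decoder, and maximal error probability at most `ε`:
`ℙ[Ŵ ≠ j | W = j] ≤ ε` for every message `j`. -/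
structure MaxDetCode {𝒳 𝒴 : Type*} [MeasurableSpace 𝒳] [MeasurableSpace 𝒴]
    (W : Kernel 𝒳 𝒴) (M : ℕ) (ε : ℝ) where
  /-- the codeword assigned to each message -/
  encoder : Fin M → 𝒳
  /-- the conditional law of the decoded message given the channel output -/
  decoder : Kernel 𝒴 (Fin M)
  isMarkovKernel_decoder : IsMarkovKernel decoder
  error_le : ∀ j : Fin M, (decoder ∘ₖ W) (encoder j) {j}ᶜ ≤ ENNReal.ofReal ε

/-- The input distribution induced by the encoder: the law of the codeword of a message that is
equiprobable on `Fin M`. -/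
def MaxDetCode.inputDist {𝒳 𝒴 : Type*} [MeasurableSpace 𝒳] [MeasurableSpace 𝒴]
    {W : Kernel 𝒳 𝒴} {M : ℕ} {ε : ℝ} (c : MaxDetCode W M ε) : Measure 𝒳 :=
  (uniformOn (Set.univ : Set (Fin M))).map c.encoder

/-- The input space of the AWGN channel with power constraint `P` at blocklength `n`: the closed
Euclidean ball of radius `√(nP)` in `ℝⁿ`. -/
abbrev AwgnInput (P : ℝ) (n : ℕ) : Type :=
  {x : EuclideanSpace ℝ (Fin n) // ‖x‖ ≤ √(n * P)}

lemma multivariateGaussian_one_eq_map {n : ℕ} (x : EuclideanSpace ℝ (Fin n)) :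
    multivariateGaussian x (1 : Matrix (Fin n) (Fin n) ℝ) =
      (stdGaussian (EuclideanSpace ℝ (Fin n))).map (fun z => x + z) := by
  simp [multivariateGaussian]

/-- The AWGN channel with power constraint `P` at blocklength `n`: the input `x` is sent to the
normal distribution on `ℝⁿ` with mean `x` and identity covariance matrix. -/
def awgn (P : ℝ) (n : ℕ) : Kernel (AwgnInput P n) (EuclideanSpace ℝ (Fin n)) where
  toFun x := multivariateGaussian x.1 1
  measurable' := by
    refine Measure.measurable_of_measurable_coe _ fun s hs => ?_
    simp_rw [multivariateGaussian_one_eq_map]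
    have h : ∀ x : AwgnInput P n,
        (stdGaussian (EuclideanSpace ℝ (Fin n))).map (fun z => x.1 + z) s =
          stdGaussian (EuclideanSpace ℝ (Fin n))
            (Prod.mk x ⁻¹' ((fun p : AwgnInput P n × EuclideanSpace ℝ (Fin n) =>
              p.1.1 + p.2) ⁻¹' s)) := by
      intro x
      rw [Measure.map_apply (by fun_prop) hs]
      rfl
    simp_rw [h]
    exact measurable_measure_prodMk_left
      ((by fun_prop : Measurable fun p : AwgnInput P n × EuclideanSpace ℝ (Fin n) =>
        p.1.1 + p.2) hs)

/-- The capacity of the AWGN channel with power constraint `P`, with logarithms to base `B`. -/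
def awgnCapacity (B P : ℝ) : ℝ := 1 / 2 * Real.logb B (1 + P)

/-- The norm `‖x‖₄ = (∑ j, |x j| ^ 4) ^ (1 / 4)` on `ℝⁿ`. -/
def l4Norm {n : ℕ} (x : EuclideanSpace ℝ (Fin n)) : ℝ :=
  (∑ j, |x j| ^ 4) ^ ((1 : ℝ) / 4)

end

open scoped ENNReal NNReal

/-! Both bounds come from a converse in which messages carry exponential weights. Let `Q` be the
capacity-achieving output law `N(0, 1 + P)` in each coordinate. Given a codeword `x`, the
log-density of the output law against `Q` has mean at most `nC` by the power constraint and variance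
`O(n)`, so it is at most `nC + O(√n)` on a likely set. Since `ε < 1/2`, the decoder still puts mass
`1/4` on the correct message there. If also `w j ≤ W y` for typical outputs of codeword `j`,
changing measure to `Q` and summing over messages gives `∑ exp (w j) ≤ exp (nC + O(√n)) * E_Q[exp
W]` (`exists_weighted_converse`). It remains to choose `W`.

For the first claim, `W` is a small multiple of `‖y‖₄²`, up to a shift under the root. Its
exponential moment under `Q` is only `exp (O(√n))`, and noise changes `‖x‖₄²` by a constant factor
plus `O(√n)`. Hence `∑ exp (b ‖x_j‖₄²) ≤ exp (nC + O(√n))`, and Markov's inequality bounds the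
number of large codewords.

For the second, `W = -l ‖y‖₄⁴` with `l` of order `n^(-1/4)`. Under `Q` the fourth power has mean
`3n(1+P)²`; given `x` it has mean at most `‖x‖₄⁴ + 6nP + 3n`. The difference is `3nP² - ‖x‖₄⁴`. The
errors, `l² n` from the moment bound and `l n^(3/4)` from concentration, are both of order `√n`.
Jensen's inequality then bounds the average gap. -/

/-! ### Product measures, Chebyshev's inequality and change of measure. -/

lemma lintegral_pi_prod {ι : Type*} [Fintype ι] (μ : ι → Measure ℝ)
    [∀ i, IsProbabilityMeasure (μ i)] (f : ι → ℝ → ℝ≥0∞) (hf : ∀ i, Measurable (f i)) :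
    ∫⁻ y, ∏ i, f i (y i) ∂(Measure.pi μ) = ∏ i, ∫⁻ y, f i y ∂(μ i) := by
  have h := lintegral_prod_eq_prod_lintegral_of_indepFun (μ := Measure.pi μ) Finset.univ
    (fun i (y : ι → ℝ) => f i (y i)) (iIndepFun_pi fun i => (hf i).aemeasurable)
    fun i => (hf i).comp (measurable_pi_apply i)
  rw [h]
  exact Finset.prod_congr rfl fun i _ => (measurePreserving_eval μ i).lintegral_comp (hf i)

lemma pi_withDensity {ι : Type*} [Fintype ι] (μ : ι → Measure ℝ) [∀ i, IsProbabilityMeasure (μ i)]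
    (f : ι → ℝ → ℝ≥0∞) (hf : ∀ i, Measurable (f i))
    [∀ i, IsProbabilityMeasure ((μ i).withDensity (f i))] :
    Measure.pi (fun i => (μ i).withDensity (f i)) =
      (Measure.pi μ).withDensity (fun y => ∏ i, f i (y i)) := by
  refine (Measure.pi_eq fun s hs => ?_)
  rw [withDensity_apply _ (MeasurableSet.univ_pi hs), ← lintegral_indicator (MeasurableSet.univ_pi hs)]
  have h : ∀ y : ι → ℝ, (Set.univ.pi s).indicator (fun y => ∏ i, f i (y i)) y =
      ∏ i, (s i).indicator (f i) (y i) := by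
    intro y
    by_cases hy : y ∈ Set.univ.pi s
    · rw [Set.indicator_of_mem hy]
      exact Finset.prod_congr rfl fun i _ => (Set.indicator_of_mem (hy i trivial) _).symm
    · rw [Set.indicator_of_notMem hy]
      simp only [Set.mem_pi, Set.mem_univ, true_imp_iff, not_forall] at hy
      obtain ⟨i, hi⟩ := hy
      exact (Finset.prod_eq_zero (Finset.mem_univ i) (Set.indicator_of_notMem hi _)).symm
  simp_rw [h]
  have hm : ∀ i, Measurable ((s i).indicator (f i)) := fun i => (hf i).indicator (hs i)
  rw [lintegral_pi_prod μ _ hm]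
  refine Finset.prod_congr rfl fun i _ => ?_
  rw [lintegral_indicator (hs i), withDensity_apply _ (hs i)]

/-- Chebyshev's inequality. The level `1/8` lets two bad events together cost `1/4`, which an error
probability below `1/2` can afford. -/
lemma pi_sum_ge_le {ι : Type*} [Fintype ι] (μ : ι → Measure ℝ) [∀ i, IsProbabilityMeasure (μ i)]
    {X : ι → ℝ → ℝ} (hX : ∀ i, MemLp (X i) 2 (μ i)) {m v s : ℝ}
    (hm : ∑ i, ∫ y, X i y ∂(μ i) ≤ m) (hv : ∑ i, Var[X i; μ i] ≤ v) (hs : 0 < s)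
    (hvs : 8 * v ≤ s ^ 2) :
    Measure.pi μ {y | m + s ≤ ∑ i, X i (y i)} ≤ ENNReal.ofReal (1 / 8) := by
  have hmem : ∀ i, MemLp (fun y : ι → ℝ => X i (y i)) 2 (Measure.pi μ) := fun i =>
    (hX i).comp_measurePreserving (measurePreserving_eval μ i)
  have hmem' : MemLp (∑ i, fun y : ι → ℝ => X i (y i)) 2 (Measure.pi μ) :=
    memLp_finsetSum' _ fun i _ => hmem i
  have hint : ∫ y, (∑ i, fun y : ι → ℝ => X i (y i)) y ∂(Measure.pi μ) =
      ∑ i, ∫ y, X i y ∂(μ i) := by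
    simp only [Finset.sum_apply]
    rw [integral_finsetSum _ fun i _ => (hmem i).integrable (by norm_num)]
    exact Finset.sum_congr rfl fun i _ => integral_comp_eval (hX i).1
  refine le_trans (measure_mono ?_) ((meas_ge_le_variance_div_sq hmem' hs).trans ?_)
  · intro y hy
    simp only [Set.mem_ofPred_eq] at hy ⊢
    rw [hint, Finset.sum_apply]
    exact le_trans (by linarith) (le_abs_self _)
  · refine ENNReal.ofReal_le_ofReal ?_
    rw [variance_sum_pi hX, div_le_div_iff₀ (by positivity) (by norm_num)]
    linarith

/-- Change of measure for a randomized decoder `D`, weighted by a test function `W`: if `D j` has mass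
at least `a` on the set `G j`, where the density `f j` is at most `Γ` and `W` is at least `w j`, then
`a ∑ w j ≤ Γ ∫ W ∂Q`. -/
lemma mul_sum_le_of_good_sets {𝒴 J : Type*} [MeasurableSpace 𝒴] [Fintype J] (Q : Measure 𝒴)
    {f D : J → 𝒴 → ℝ≥0∞} (hf : ∀ j, Measurable (f j)) (hD : ∀ j, Measurable (D j))
    (hsum : ∀ y, ∑ j, D j y ≤ 1) {G : J → Set 𝒴} (hG : ∀ j, MeasurableSet (G j))
    {w : J → ℝ≥0∞} {W : 𝒴 → ℝ≥0∞} (hW : Measurable W) {Γ a : ℝ≥0∞} (S : Finset J)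
    (ha : ∀ j ∈ S, a ≤ ∫⁻ y in G j, D j y ∂(Q.withDensity (f j)))
    (hΓ : ∀ j ∈ S, ∀ y ∈ G j, f j y ≤ Γ) (hw : ∀ j ∈ S, ∀ y ∈ G j, w j ≤ W y) :
    a * ∑ j ∈ S, w j ≤ Γ * ∫⁻ y, W y ∂Q := by
  have key : ∀ j ∈ S, a * w j ≤ ∫⁻ y, Γ * (D j y * W y) ∂Q := by
    intro j hj
    calc a * w j ≤ (∫⁻ y in G j, D j y ∂(Q.withDensity (f j))) * w j := by gcongr; exact ha j hj
      _ = (∫⁻ y in G j, f j y * D j y ∂Q) * w j := by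
        rw [restrict_withDensity (hG j), lintegral_withDensity_eq_lintegral_mul _ (hf j) (hD j)]
        rfl
      _ = ∫⁻ y in G j, f j y * D j y * w j ∂Q := by
        exact (lintegral_mul_const _ ((hf j).mul (hD j))).symm
      _ ≤ ∫⁻ y in G j, Γ * (D j y * W y) ∂Q := by
        refine setLIntegral_mono (by fun_prop) fun y hy => ?_
        rw [mul_assoc]
        gcongr
        · exact hΓ j hj y hy
        · exact hw j hj y hy
      _ ≤ _ := setLIntegral_le_lintegral _ _
  rw [Finset.mul_sum]
  refine (Finset.sum_le_sum key).trans ?_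
  rw [← lintegral_finsetSum _ fun j _ => by fun_prop, ← lintegral_const_mul _ hW]
  refine lintegral_mono fun y => ?_
  rw [← Finset.mul_sum, ← Finset.sum_mul]
  gcongr
  calc (∑ j ∈ S, D j y) * W y ≤ (∑ j, D j y) * W y := by
        gcongr; exact Finset.subset_univ S
    _ ≤ 1 * W y := by gcongr; exact hsum y
    _ = W y := one_mul _

/-! ### Moments and densities of one-dimensional Gaussians. -/

section Gaussian

lemma integral_pow_gaussianReal_of_mgf (v : ℝ≥0) (k : ℕ) :
    ∫ y, y ^ k ∂(gaussianReal 0 v) =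
      iteratedDeriv k (fun t : ℝ => Real.exp (v * t ^ 2 / 2)) 0 := by
  have h := iteratedDeriv_mgf_zero (X := id) (μ := gaussianReal 0 v)
    (by rw [integrableExpSet_id_gaussianReal]; simp) k
  rw [mgf_id_gaussianReal] at h
  simpa using h.symm

lemma integral_pow_three_four_gaussianReal (v : ℝ≥0) :
    ∫ y, y ^ 3 ∂(gaussianReal 0 v) = 0 ∧ ∫ y, y ^ 4 ∂(gaussianReal 0 v) = 3 * (v : ℝ) ^ 2 := by
  have h0 : ∀ t : ℝ, HasDerivAt (fun t : ℝ => Real.exp (v * t ^ 2 / 2))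
      (Real.exp (v * t ^ 2 / 2) * (v * t)) t := by
    intro t
    have := ((((hasDerivAt_id' t).fun_pow 2).const_mul (v : ℝ)).div_const 2).exp
    convert this using 1
    simp; ring
  -- Each derivative of the moment generating function is that function times a polynomial;
  -- differentiation sends `p` to `v t p + p'`.
  have step : ∀ (p p' : ℝ → ℝ), (∀ t, HasDerivAt p (p' t) t) →
      deriv (fun t : ℝ => Real.exp (v * t ^ 2 / 2) * p t) =
        fun t => Real.exp (v * t ^ 2 / 2) * (v * t * p t + p' t) := by
    intro p p' hp
    ext t
    rw [((h0 t).fun_mul (hp t)).deriv]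
    ring
  have e1 : deriv (fun t : ℝ => Real.exp (v * t ^ 2 / 2)) =
      fun t => Real.exp (v * t ^ 2 / 2) * (v * t) := by
    ext t; exact (h0 t).deriv
  have e2 := step (fun t => v * t) (fun _ => v) fun t => by
    simpa using (hasDerivAt_id t).const_mul (v : ℝ)
  have e3 := step (fun t => v * t * (v * t) + v) (fun t => v * (v * t) + v * t * v) fun t => by
    have := ((hasDerivAt_id t).const_mul (v : ℝ))
    simpa using (this.mul this).add_const (v : ℝ)
  have e4 := step (fun t => v * t * (v * t * (v * t) + v) + (v * (v * t) + v * t * v))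
    (fun t => v * (v * t * (v * t) + v) + v * t * (v * (v * t) + v * t * v) + (v * v + v * v))
    fun t => by
      have h := ((hasDerivAt_id t).const_mul (v : ℝ))
      have := (h.fun_mul ((h.fun_mul h).add_const (v : ℝ))).fun_add
        ((h.const_mul (v : ℝ)).fun_add (h.mul_const v))
      simpa using this
  constructor
  · rw [integral_pow_gaussianReal_of_mgf, iteratedDeriv_succ, iteratedDeriv_succ, iteratedDeriv_one,
      e1, e2, e3]
    simp
  · rw [integral_pow_gaussianReal_of_mgf, iteratedDeriv_succ, iteratedDeriv_succ, iteratedDeriv_succ,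
      iteratedDeriv_one, e1, e2, e3, e4]
    simp; ring

lemma integrable_pow_gaussianReal (m : ℝ) (v : ℝ≥0) (k : ℕ) :
    Integrable (fun y => y ^ k) (gaussianReal m v) := by
  rcases Nat.eq_zero_or_pos k with rfl | hk
  · simp
  · have h := (memLp_id_gaussianReal' (μ := m) (v := v) k (by simp)).integrable_norm_pow hk.ne'
    refine h.congr' (by fun_prop) (ae_of_all _ fun y => ?_)
    simp

lemma integral_sq_gaussianReal (v : ℝ≥0) : ∫ y, y ^ 2 ∂(gaussianReal 0 v) = v := by
  have h := variance_id_gaussianReal (μ := 0) (v := v)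
  rw [variance_eq_integral aemeasurable_id] at h
  simpa using h

lemma integral_gaussianReal_eq_shift (x : ℝ) {f : ℝ → ℝ} (hf : Measurable f) :
    ∫ y, f y ∂(gaussianReal x 1) = ∫ z, f (x + z) ∂(gaussianReal 0 1) := by
  have h : gaussianReal x 1 = (gaussianReal 0 1).map (x + ·) := by
    rw [gaussianReal_map_const_add]; simp
  rw [h, integral_map (by fun_prop) hf.aestronglyMeasurable]

lemma gaussianReal_one_eq_withDensity (x : ℝ) {v : ℝ≥0} (hv : v ≠ 0) :
    gaussianReal x 1 = (gaussianReal 0 v).withDensity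
      (fun y => ENNReal.ofReal (√v * Real.exp (y ^ 2 / (2 * v) - (y - x) ^ 2 / 2))) := by
  rw [gaussianReal_of_var_ne_zero _ one_ne_zero, gaussianReal_of_var_ne_zero _ hv,
    ← withDensity_mul _ (by fun_prop) (by fun_prop)]
  congr 1
  ext y
  have hv' : (0 : ℝ) < v := by positivity
  rw [Pi.mul_apply, gaussianPDF, gaussianPDF, ← ENNReal.ofReal_mul (gaussianPDFReal_nonneg _ _ _)]
  congr 1
  rw [gaussianPDFReal, gaussianPDFReal, Real.sqrt_mul' _ hv'.le]
  rw [show (√(2 * Real.pi) * √(v : ℝ))⁻¹ * Real.exp (-(y - 0) ^ 2 / (2 * v)) *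
      (√v * Real.exp (y ^ 2 / (2 * v) - (y - x) ^ 2 / 2)) = (√(v:ℝ) * (√v)⁻¹) * ((√(2 * Real.pi))⁻¹ *
      (Real.exp (-(y - 0) ^ 2 / (2 * v)) * Real.exp (y ^ 2 / (2 * v) - (y - x) ^ 2 / 2))) by
      rw [mul_inv]; ring, ← Real.exp_add, mul_inv_cancel₀ (by positivity), one_mul]
  simp only [NNReal.coe_one, mul_one]
  congr 2
  ring

end Gaussian

lemma integrable_polynomial_gaussianReal (m : ℝ) (v : ℝ≥0) (p : Polynomial ℝ) :
    Integrable (fun y => p.eval y) (gaussianReal m v) := by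
  simp_rw [Polynomial.eval_eq_sum, Polynomial.sum]
  exact integrable_finsetSum _ fun i _ => (integrable_pow_gaussianReal m v i).const_mul _

lemma memLp_two_polynomial_gaussianReal (m : ℝ) (v : ℝ≥0) (p : Polynomial ℝ) :
    MemLp (fun y => p.eval y) 2 (gaussianReal m v) := by
  rw [memLp_two_iff_integrable_sq p.continuous.aestronglyMeasurable]
  exact (integrable_polynomial_gaussianReal m v (p ^ 2)).congr
    (ae_of_all _ fun y => Polynomial.eval_pow 2)

/-! ### Exponential moments of the test functions under the output law. -/

/-- Follows from `(1 + u + u²/2)(1 - u + u²/2) = 1 + u⁴/4 ≥ 1`. -/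
lemma exp_neg_le_quadratic {u : ℝ} (hu : 0 ≤ u) : Real.exp (-u) ≤ 1 - u + u ^ 2 / 2 := by
  have h1 := Real.quadratic_le_exp_of_nonneg hu
  have h2 : 0 < 1 - u + u ^ 2 / 2 := by nlinarith [sq_nonneg (u - 1)]
  rw [Real.exp_neg, inv_le_comm₀ (Real.exp_pos _) h2, inv_le_iff_one_le_mul₀ h2]
  nlinarith [mul_le_mul_of_nonneg_right h1 h2.le, sq_nonneg (u ^ 2)]

lemma lintegral_exp_neg_pow_four_le (v : ℝ≥0) {l : ℝ} (hl : 0 ≤ l) :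
    ∫⁻ y, ENNReal.ofReal (Real.exp (-l * y ^ 4)) ∂(gaussianReal 0 v) ≤
      ENNReal.ofReal (Real.exp (-3 * l * (v : ℝ) ^ 2 +
        l ^ 2 * (∫ y, y ^ 8 ∂(gaussianReal 0 v)) / 2)) := by
  have h4 := integrable_pow_gaussianReal 0 v 4
  have h8 := integrable_pow_gaussianReal 0 v 8
  have hp : ∀ y : ℝ, Real.exp (-l * y ^ 4) ≤ 1 - l * y ^ 4 + l ^ 2 / 2 * y ^ 8 := fun y => by
    have := exp_neg_le_quadratic (u := l * y ^ 4) (by positivity)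
    rw [neg_mul]
    exact this.trans (by ring_nf; rfl)
  have hi : Integrable (fun y : ℝ => 1 - l * y ^ 4 + l ^ 2 / 2 * y ^ 8) (gaussianReal 0 v) :=
    ((integrable_const _).sub (h4.const_mul _)).add (h8.const_mul _)
  calc ∫⁻ y, ENNReal.ofReal (Real.exp (-l * y ^ 4)) ∂(gaussianReal 0 v)
      ≤ ∫⁻ y, ENNReal.ofReal (1 - l * y ^ 4 + l ^ 2 / 2 * y ^ 8) ∂(gaussianReal 0 v) :=
        lintegral_mono fun y => ENNReal.ofReal_le_ofReal (hp y)
    _ = ENNReal.ofReal (∫ y, (1 - l * y ^ 4 + l ^ 2 / 2 * y ^ 8) ∂(gaussianReal 0 v)) :=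
        (ofReal_integral_eq_lintegral_ofReal hi
          (ae_of_all _ fun y => (Real.exp_pos _).le.trans (hp y))).symm
    _ ≤ _ := by
        refine ENNReal.ofReal_le_ofReal ?_
        rw [integral_add (f := fun y => 1 - l * y ^ 4)
          ((integrable_const _).sub (h4.const_mul _)) (h8.const_mul _),
          integral_sub (integrable_const _) (h4.const_mul _), integral_const_mul,
          integral_const_mul, (integral_pow_three_four_gaussianReal v).2]
        simp only [integral_const, probReal_univ, smul_eq_mul, one_mul]
        refine le_trans (le_of_eq ?_) (Real.add_one_le_exp _)
        ring

lemma lintegral_exp_neg_sum_pow_four_le (n : ℕ) (v : ℝ≥0) {l : ℝ} (hl : 0 ≤ l) :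
    ∫⁻ y, ENNReal.ofReal (Real.exp (-l * ∑ i, y i ^ 4))
        ∂(Measure.pi fun _ : Fin n => gaussianReal 0 v) ≤
      ENNReal.ofReal (Real.exp (n * (-3 * l * (v : ℝ) ^ 2 +
        l ^ 2 * (∫ y, y ^ 8 ∂(gaussianReal 0 v)) / 2))) := by
  have h : ∀ y : Fin n → ℝ, ENNReal.ofReal (Real.exp (-l * ∑ i, y i ^ 4)) =
      ∏ i, ENNReal.ofReal (Real.exp (-l * y i ^ 4)) := fun y => by
    rw [Finset.mul_sum, Real.exp_sum, ENNReal.ofReal_prod_of_nonneg fun _ _ => (Real.exp_pos _).le]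
  simp_rw [h]
  rw [lintegral_pi_prod (fun _ : Fin n => gaussianReal 0 v)
    (fun _ y => ENNReal.ofReal (Real.exp (-l * y ^ 4))) fun _ => by fun_prop, Finset.prod_const,
    Finset.card_univ, Fintype.card_fin, Real.exp_nat_mul, ENNReal.ofReal_pow (Real.exp_pos _).le]
  gcongr
  exact lintegral_exp_neg_pow_four_le v hl

/-- Averaging over one coordinate replaces `y ^ 4` by the constant `A` and keeps the shape `√(s +
·)`, so the bound can be iterated over coordinates with `b` independent of the dimension. For large
`s` the root is nearly linear, so the average costs only a factor `1 + O(1/√s)`. -/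
lemma exists_lintegral_exp_sqrt_add_pow_four_le (v : ℝ≥0) :
    ∃ b : ℝ, 0 < b ∧ ∃ A : ℝ, 1 ≤ A ∧ ∀ s, A ≤ s →
      ∫⁻ y, ENNReal.ofReal (Real.exp (b * √(s + y ^ 4))) ∂(gaussianReal 0 v) ≤
        ENNReal.ofReal (Real.exp (b * √(s + A))) := by
  obtain ⟨C, hC, hint⟩ := IsGaussian.exists_integrable_exp_sq (gaussianReal 0 v)
  -- Half of the Fernique exponent is kept in reserve to absorb the factor `y ^ 4`.
  set b := C / 2 with hb
  have hb0 : 0 < b := by positivity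
  have hi : Integrable (fun y : ℝ => y ^ 4 * Real.exp (b * y ^ 2)) (gaussianReal 0 v) := by
    refine (hint.const_mul (2 / b ^ 2)).mono' (by fun_prop) (ae_of_all _ fun y => ?_)
    have h1 := Real.quadratic_le_exp_of_nonneg (x := b * y ^ 2) (by positivity)
    have h2 : y ^ 4 ≤ 2 / b ^ 2 * Real.exp (b * y ^ 2) := by
      rw [div_mul_eq_mul_div, le_div_iff₀ (by positivity)]
      nlinarith [mul_nonneg hb0.le (sq_nonneg y)]
    rw [Real.norm_of_nonneg (by positivity), Real.norm_eq_abs, sq_abs]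
    have h3 : Real.exp (C * y ^ 2) = Real.exp (b * y ^ 2) * Real.exp (b * y ^ 2) := by
      rw [← Real.exp_add]; congr 1; rw [hb]; ring
    rw [h3, ← mul_assoc]
    gcongr
  set K := ∫ y, y ^ 4 * Real.exp (b * y ^ 2) ∂(gaussianReal 0 v) with hK
  have hK0 : 0 ≤ K := integral_nonneg fun y => by positivity
  refine ⟨b, hb0, 2 * K + 1, by linarith, fun s hs => ?_⟩
  have hs0 : 0 < s := by linarith
  have hr : 0 < √s := Real.sqrt_pos.2 hs0
  have hrs : √s ^ 2 = s := Real.sq_sqrt hs0.le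
  have hp : ∀ y : ℝ, Real.exp (b * √(s + y ^ 4)) ≤
      Real.exp (b * √s) * (1 + b / (2 * √s) * (y ^ 4 * Real.exp (b * y ^ 2))) := by
    intro y
    -- The increment of the root has two bounds: this one supplies the decay in `s`, while the next,
    -- free of `s`, controls the exponential.
    have u1 : √(s + y ^ 4) - √s ≤ y ^ 4 / (2 * √s) := by
      rw [sub_le_iff_le_add]
      refine Real.sqrt_le_iff.2 ⟨by positivity, ?_⟩
      have : (y ^ 4 / (2 * √s) + √s) ^ 2 = (y ^ 4 / (2 * √s)) ^ 2 + y ^ 4 + √s ^ 2 := by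
        field_simp
        ring
      rw [this, hrs]
      nlinarith [sq_nonneg (y ^ 4 / (2 * √s))]
    have u2 : √(s + y ^ 4) - √s ≤ y ^ 2 := by
      rw [sub_le_iff_le_add]
      refine Real.sqrt_le_iff.2 ⟨by positivity, ?_⟩
      nlinarith [mul_nonneg (sq_nonneg y) hr.le]
    have u0 : 0 ≤ √(s + y ^ 4) - √s :=
      sub_nonneg.2 (Real.sqrt_le_sqrt (by nlinarith [sq_nonneg (y ^ 2)]))
    set u := b * (√(s + y ^ 4) - √s) with hu
    have e1 : Real.exp u ≤ 1 + u * Real.exp u := by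
      have h := Real.add_one_le_exp (-u)
      have h2 : Real.exp (-u) * Real.exp u = 1 := by rw [← Real.exp_add]; simp
      nlinarith [Real.exp_pos u]
    have e2 : u * Real.exp u ≤ b / (2 * √s) * (y ^ 4 * Real.exp (b * y ^ 2)) := by
      calc u * Real.exp u ≤ (b * (y ^ 4 / (2 * √s))) * Real.exp (b * y ^ 2) := by
            gcongr
            · exact mul_le_mul_of_nonneg_left u1 hb0.le
            · exact mul_le_mul_of_nonneg_left u2 hb0.le
        _ = _ := by ring
    have e3 : Real.exp (b * √(s + y ^ 4)) = Real.exp (b * √s) * Real.exp u := by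
      rw [← Real.exp_add]; congr 1; rw [hu]; ring
    rw [e3]
    gcongr
    linarith
  calc ∫⁻ y, ENNReal.ofReal (Real.exp (b * √(s + y ^ 4))) ∂(gaussianReal 0 v)
      ≤ ∫⁻ y, ENNReal.ofReal (Real.exp (b * √s) *
          (1 + b / (2 * √s) * (y ^ 4 * Real.exp (b * y ^ 2)))) ∂(gaussianReal 0 v) :=
        lintegral_mono fun y => ENNReal.ofReal_le_ofReal (hp y)
    _ = ENNReal.ofReal (∫ y, Real.exp (b * √s) *
          (1 + b / (2 * √s) * (y ^ 4 * Real.exp (b * y ^ 2))) ∂(gaussianReal 0 v)) := by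
        refine (ofReal_integral_eq_lintegral_ofReal ?_ (ae_of_all _ fun y => ?_)).symm
        · exact ((integrable_const _).add (hi.const_mul _)).const_mul _
        · exact (Real.exp_pos _).le.trans (hp y)
    _ ≤ _ := by
        refine ENNReal.ofReal_le_ofReal ?_
        rw [integral_const_mul, integral_add (integrable_const _) (hi.const_mul _),
          integral_const_mul, ← hK]
        simp only [integral_const, probReal_univ, smul_eq_mul, one_mul]
        calc Real.exp (b * √s) * (1 + b / (2 * √s) * K)
            ≤ Real.exp (b * √s) * Real.exp (b / (2 * √s) * K) := by
              gcongr; linarith [Real.add_one_le_exp (b / (2 * √s) * K)]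
          _ = Real.exp (b * (√s + K / (2 * √s))) := by
              rw [← Real.exp_add]; congr 1; ring
          _ ≤ _ := by
              gcongr
              -- The square is `s + K + K²/(4s)`, at most `s + 2K` because `s ≥ 2K + 1`; this fixes
              -- `A`.
              refine Real.le_sqrt_of_sq_le ?_
              have : (√s + K / (2 * √s)) ^ 2 = √s ^ 2 + K + K ^ 2 / (4 * √s ^ 2) := by
                field_simp
                ring
              rw [this, hrs]
              have : K ^ 2 / (4 * s) ≤ K := by
                rw [div_le_iff₀ (by positivity)]; nlinarith
              linarith

/-- Square-exponential moment of the `ℓ⁴` norm of a Gaussian vector, by integrating out one coordinate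
at a time. -/
lemma lintegral_exp_sqrt_add_sum_pow_four_le {v : ℝ≥0} {b A : ℝ} (hA : 0 ≤ A)
    (h : ∀ s, A ≤ s →
      ∫⁻ y, ENNReal.ofReal (Real.exp (b * √(s + y ^ 4))) ∂(gaussianReal 0 v) ≤
        ENNReal.ofReal (Real.exp (b * √(s + A)))) (n : ℕ) :
    ∀ s, A ≤ s → ∫⁻ y, ENNReal.ofReal (Real.exp (b * √(s + ∑ i, y i ^ 4)))
        ∂(Measure.pi fun _ : Fin n => gaussianReal 0 v) ≤
      ENNReal.ofReal (Real.exp (b * √(s + n * A))) := by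
  induction n with
  | zero => intro s _; simp
  | succ n ih =>
    intro s hs
    have hmp := (measurePreserving_piFinSuccAbove (fun _ : Fin (n + 1) => gaussianReal 0 v) 0).symm
    rw [← hmp.lintegral_comp (by fun_prop), lintegral_prod_symm _ (by fun_prop)]
    simp only [MeasurableEquiv.piFinSuccAbove_symm_apply, Fin.insertNthEquiv_zero,
      Fin.consEquiv_apply, Fin.sum_univ_succ, Fin.cons_zero, Fin.cons_succ]
    calc _ ≤ ∫⁻ y, ENNReal.ofReal (Real.exp (b * √((s + A) + ∑ i, y i ^ 4)))
        ∂(Measure.pi fun _ : Fin n => gaussianReal 0 v) := by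
          refine lintegral_mono fun z => ?_
          have hz : 0 ≤ ∑ i, z i ^ 4 := Finset.sum_nonneg fun i _ => by positivity
          -- The remaining coordinates only enlarge `s`, so the threshold `A ≤ s` persists.
          have := h (s + ∑ i, z i ^ 4) (by linarith)
          refine le_trans (le_of_eq ?_) (this.trans (le_of_eq ?_))
          · refine lintegral_congr fun y => ?_
            rw [add_assoc, add_comm (∑ i, z i ^ 4)]
          · rw [add_right_comm]
      _ ≤ _ := by
          refine (ih (s + A) (by linarith)).trans (le_of_eq ?_)
          push_cast
          ring_nf

/-! ### Concentration of the output given a codeword. -/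

lemma integral_quartic_gaussianReal (a₀ a₁ a₂ a₃ a₄ : ℝ) :
    ∫ z, (a₀ + a₁ * z + a₂ * z ^ 2 + a₃ * z ^ 3 + a₄ * z ^ 4) ∂(gaussianReal 0 1) =
      a₀ + a₂ + 3 * a₄ := by
  have i := integrable_pow_gaussianReal 0 1
  have i0 : Integrable (fun _ : ℝ => a₀) (gaussianReal 0 1) := integrable_const _
  have i1 : Integrable (fun z => a₁ * z) (gaussianReal 0 1) := by
    simpa using (i 1).const_mul a₁
  have i2 := (i 2).const_mul a₂
  have i3 := (i 3).const_mul a₃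
  have i4 := (i 4).const_mul a₄
  rw [integral_add (f := fun z => a₀ + a₁ * z + a₂ * z ^ 2 + a₃ * z ^ 3)
      (((i0.add i1).add i2).add i3) i4,
    integral_add (f := fun z => a₀ + a₁ * z + a₂ * z ^ 2) ((i0.add i1).add i2) i3,
    integral_add (f := fun z => a₀ + a₁ * z) (i0.add i1) i2, integral_add i0 i1]
  simp only [integral_const_mul]
  rw [integral_sq_gaussianReal, (integral_pow_three_four_gaussianReal 1).1,
    (integral_pow_three_four_gaussianReal 1).2, integral_const_mul, integral_id_gaussianReal]
  simp; ring

/-- The second moment about any `c` dominates the variance. Taking the noiseless value `f x` for `c`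
avoids centring at the exact mean. -/
lemma variance_gaussianReal_le (x c : ℝ) {f g : ℝ → ℝ} (hf : Measurable f)
    (hg : Integrable g (gaussianReal 0 1)) (h : ∀ z, (f (x + z) - c) ^ 2 ≤ g z) :
    Var[f; gaussianReal x 1] ≤ ∫ z, g z ∂(gaussianReal 0 1) := by
  rw [← variance_sub_const hf.aestronglyMeasurable c]
  refine (variance_le_expectation_sq (by fun_prop)).trans ?_
  simp only [Pi.pow_apply]
  rw [integral_gaussianReal_eq_shift x (f := fun y => (f y - c) ^ 2) (by fun_prop)]
  exact integral_mono_of_nonneg (ae_of_all _ fun z => sq_nonneg _) hg (ae_of_all _ h)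

/-- The sum is the log-density against `Q` without its constant `nC`. Its mean is `∑ (x i ^ 2 - P) /
(2 (1 + P)) ≤ 0` by the power constraint, and its variance is at most `n (2P + 3)`. -/
lemma pi_gaussian_infoDensity_tail {n : ℕ} (hn : 1 ≤ n) {P : ℝ} (hP : 0 < P) (x : Fin n → ℝ)
    (hx : ∑ i, x i ^ 2 ≤ n * P) :
    Measure.pi (fun i => gaussianReal (x i) 1) {y | √(8 * (2 * P + 3)) * √n ≤
        ∑ i, (y i ^ 2 / (2 * (1 + P)) - (y i - x i) ^ 2 / 2)} ≤ ENNReal.ofReal (1 / 8) := by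
  have hn' : (0 : ℝ) < n := by exact_mod_cast hn
  have hmem : ∀ i, MemLp (fun y => y ^ 2 / (2 * (1 + P)) - (y - x i) ^ 2 / 2) 2
      (gaussianReal (x i) 1) := fun i => by
    have := memLp_two_polynomial_gaussianReal (x i) 1 (Polynomial.C (1 / (2 * (1 + P))) *
      Polynomial.X ^ 2 - Polynomial.C (1 / 2) * (Polynomial.X - Polynomial.C (x i)) ^ 2)
    convert this using 2 with y
    simp only [Polynomial.eval_sub, Polynomial.eval_mul, Polynomial.eval_C, Polynomial.eval_pow,
      Polynomial.eval_X]
    field_simp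
  have hmean : ∀ i, ∫ y, (y ^ 2 / (2 * (1 + P)) - (y - x i) ^ 2 / 2) ∂(gaussianReal (x i) 1) =
      (x i ^ 2 - P) / (2 * (1 + P)) := fun i => by
    rw [integral_gaussianReal_eq_shift (x i) (by fun_prop)]
    convert integral_quartic_gaussianReal (x i ^ 2 / (2 * (1 + P))) (x i / (1 + P))
      (1 / (2 * (1 + P)) - 1 / 2) 0 0 using 2
    · ext z; field_simp; ring
    · field_simp; ring
  have hvar : ∀ i, Var[fun y => y ^ 2 / (2 * (1 + P)) - (y - x i) ^ 2 / 2; gaussianReal (x i) 1] ≤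
      2 * x i ^ 2 + 3 := fun i => by
    refine (variance_gaussianReal_le (x i) (x i ^ 2 / (2 * (1 + P))) (by fun_prop)
      (g := fun z => 0 + 0 * z + 2 * x i ^ 2 * z ^ 2 + 0 * z ^ 3 + 1 * z ^ 4) ?_ ?_).trans
      (le_of_eq ?_)
    · have := integrable_polynomial_gaussianReal 0 1 (Polynomial.C (2 * x i ^ 2) *
        Polynomial.X ^ 2 + Polynomial.X ^ 4)
      convert this using 2 with z
      simp
    · intro z
      have h1 : 0 ≤ 1 / (1 + P) := by positivity
      have h2 : 1 / (1 + P) ≤ 1 := by rw [div_le_one (by positivity)]; linarith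
      have e : (x i + z) ^ 2 / (2 * (1 + P)) - (x i + z - x i) ^ 2 / 2 - x i ^ 2 / (2 * (1 + P)) =
          1 / (1 + P) * (x i * z) + (1 / (1 + P) - 1) / 2 * z ^ 2 := by field_simp; ring
      rw [e]
      set t := 1 / (1 + P)
      have k1 : t ^ 2 ≤ 1 := by nlinarith
      have k2 : ((t - 1) / 2) ^ 2 ≤ 1 / 4 := by nlinarith
      have : (t * (x i * z) + (t - 1) / 2 * z ^ 2) ^ 2 ≤
          2 * (t ^ 2 * (x i * z) ^ 2) + 2 * (((t - 1) / 2) ^ 2 * (z ^ 2) ^ 2) := by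
        nlinarith [sq_nonneg (t * (x i * z) - (t - 1) / 2 * z ^ 2)]
      nlinarith [mul_le_mul_of_nonneg_right k1 (sq_nonneg (x i * z)),
        mul_le_mul_of_nonneg_right k2 (sq_nonneg (z ^ 2)), sq_nonneg (z ^ 2)]
    · rw [integral_quartic_gaussianReal]; ring
  have key := pi_sum_ge_le (fun i => gaussianReal (x i) 1) hmem (m := 0)
    (v := n * (2 * P + 3)) (s := √(8 * (2 * P + 3)) * √n) ?_ ?_ (by positivity) ?_
  · simpa using key
  · simp_rw [hmean]
    rw [← Finset.sum_div, Finset.sum_sub_distrib]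
    refine div_nonpos_of_nonpos_of_nonneg ?_ (by positivity)
    simp only [Finset.sum_const, Finset.card_univ, Fintype.card_fin, nsmul_eq_mul]
    linarith
  · refine (Finset.sum_le_sum fun i _ => hvar i).trans ?_
    rw [Finset.sum_add_distrib, ← Finset.mul_sum]
    simp only [Finset.sum_const, Finset.card_univ, Fintype.card_fin, nsmul_eq_mul]
    nlinarith
  · rw [mul_pow, Real.sq_sqrt (by positivity), Real.sq_sqrt hn'.le]
    linarith

lemma exists_pi_gaussian_noise_pow_four_tail :
    ∃ C : ℝ, 0 < C ∧ ∀ n : ℕ, 1 ≤ n → ∀ x : Fin n → ℝ,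
      Measure.pi (fun i => gaussianReal (x i) 1) {y | C * n ≤ ∑ i, (y i - x i) ^ 4} ≤
        ENNReal.ofReal (1 / 8) := by
  set m := ∫ z, z ^ 8 ∂(gaussianReal 0 1) with hm
  have hm0 : 0 ≤ m := integral_nonneg fun z => by positivity
  refine ⟨3 + √(8 * (m + 1)), by positivity, fun n hn x => ?_⟩
  have hn' : (1 : ℝ) ≤ n := by exact_mod_cast hn
  have hmem : ∀ i, MemLp (fun y => (y - x i) ^ 4) 2 (gaussianReal (x i) 1) := fun i => by
    have := memLp_two_polynomial_gaussianReal (x i) 1 ((Polynomial.X - Polynomial.C (x i)) ^ 4)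
    convert this using 2 with y
    simp
  have hmean : ∀ i, ∫ y, (y - x i) ^ 4 ∂(gaussianReal (x i) 1) = 3 := fun i => by
    rw [integral_gaussianReal_eq_shift (x i) (by fun_prop)]
    simp [(integral_pow_three_four_gaussianReal 1).2]
  have hvar : ∀ i, Var[fun y => (y - x i) ^ 4; gaussianReal (x i) 1] ≤ m := fun i =>
    variance_gaussianReal_le (x i) 0 (by fun_prop) (integrable_pow_gaussianReal 0 1 8)
      fun z => by ring_nf; rfl
  refine le_trans (measure_mono ?_) (pi_sum_ge_le (fun i => gaussianReal (x i) 1) hmem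
    (m := 3 * n) (v := n * m) (s := √(8 * (m + 1)) * n) ?_ ?_ (by positivity) ?_)
  · intro y hy
    simp only [Set.mem_ofPred_eq] at hy ⊢
    linarith
  · simp [hmean, mul_comm]
  · exact (Finset.sum_le_sum fun i _ => hvar i).trans (by simp)
  · rw [mul_pow, Real.sq_sqrt (by positivity)]
    nlinarith [mul_nonneg hm0 (sub_nonneg.2 hn'), mul_nonneg (mul_nonneg hm0 (sub_nonneg.2 hn'))
      (sub_nonneg.2 hn')]

lemma sum_pow_six_le {n : ℕ} (x : Fin n → ℝ) {t : ℝ} (ht : 0 ≤ t) (h : ∑ i, x i ^ 4 ≤ t ^ 2) :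
    ∑ i, x i ^ 6 ≤ t ^ 3 := by
  have hi : ∀ i, x i ^ 2 ≤ t := fun i => by
    have : x i ^ 4 ≤ ∑ i, x i ^ 4 :=
      Finset.single_le_sum (f := fun i => x i ^ 4) (fun i _ => by positivity) (Finset.mem_univ i)
    exact le_of_sq_le_sq (by nlinarith) ht
  calc ∑ i, x i ^ 6 ≤ ∑ i, t * x i ^ 4 := Finset.sum_le_sum fun i _ => by
        nlinarith [mul_le_mul_of_nonneg_right (hi i) (by positivity : 0 ≤ x i ^ 4)]
    _ = t * ∑ i, x i ^ 4 := (Finset.mul_sum _ _ _).symm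
    _ ≤ t * t ^ 2 := by gcongr
    _ = t ^ 3 := by ring

/-- The intermediate terms `x⁴z⁴` and `x²z⁶` interpolate between `x⁶z²` and `z⁸`; `272 = 64 + 144 +
64`. -/
lemma sq_shift_pow_four_sub_le (x z : ℝ) :
    ((x + z) ^ 4 - x ^ 4) ^ 2 ≤ 272 * (x ^ 6 * z ^ 2 + z ^ 8) := by
  have key : ∀ a c : ℝ, 0 ≤ a → 0 ≤ c → a ^ 2 * c ≤ a ^ 3 + c ^ 3 := fun a c ha hc => by
    rcases le_total a c with h | h
    · have : a ^ 2 ≤ c ^ 2 := pow_le_pow_left₀ ha h 2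
      nlinarith [mul_le_mul_of_nonneg_right this hc, pow_nonneg ha 3]
    · nlinarith [mul_le_mul_of_nonneg_left h (sq_nonneg a), pow_nonneg hc 3]
  have h1 : x ^ 4 * z ^ 4 ≤ x ^ 6 * z ^ 2 + z ^ 8 := by
    have := mul_le_mul_of_nonneg_left (key (x ^ 2) (z ^ 2) (sq_nonneg x) (sq_nonneg z)) (sq_nonneg z)
    linarith
  have h2 : x ^ 2 * z ^ 6 ≤ x ^ 6 * z ^ 2 + z ^ 8 := by
    have := mul_le_mul_of_nonneg_left (key (z ^ 2) (x ^ 2) (sq_nonneg z) (sq_nonneg x)) (sq_nonneg z)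
    linarith
  have h3 : 0 ≤ x ^ 6 * z ^ 2 := by positivity
  have h4 : 0 ≤ z ^ 8 := by positivity
  have e : (x + z) ^ 4 - x ^ 4 = 4 * (x ^ 3 * z) + 6 * (x ^ 2 * z ^ 2) + 4 * (x * z ^ 3) + z ^ 4 := by
    ring
  have h : ∀ a b c d : ℝ, (a + b + c + d) ^ 2 ≤ 4 * (a ^ 2 + b ^ 2 + c ^ 2 + d ^ 2) :=
    fun a b c d => by
      nlinarith [sq_nonneg (a - b), sq_nonneg (a - c), sq_nonneg (a - d), sq_nonneg (b - c),
        sq_nonneg (b - d), sq_nonneg (c - d)]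
  rw [e]
  refine (h _ _ _ _).trans ?_
  have e2 : 4 * ((4 * (x ^ 3 * z)) ^ 2 + (6 * (x ^ 2 * z ^ 2)) ^ 2 + (4 * (x * z ^ 3)) ^ 2 +
      (z ^ 4) ^ 2) = 64 * (x ^ 6 * z ^ 2) + 144 * (x ^ 4 * z ^ 4) + 64 * (x ^ 2 * z ^ 6) +
      4 * z ^ 8 := by ring
  rw [e2]
  linarith

/-- The variance is governed by `∑ x i ^ 6 ≤ (∑ x i ^ 4)^(3/2)`, which the `ℓ⁴` hypothesis makes
`O(n^(3/2))`; hence the deviation `r ^ 3 = n^(3/4)`. -/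
lemma exists_pi_gaussian_pow_four_tail {P : ℝ} (hP : 0 < P) :
    ∃ C : ℝ, 0 < C ∧ ∀ (n : ℕ) (r : ℝ), 1 ≤ r → r ^ 4 = n → ∀ x : Fin n → ℝ,
      ∑ i, x i ^ 2 ≤ n * P → ∑ i, x i ^ 4 ≤ 3 * n * P ^ 2 →
      Measure.pi (fun i => gaussianReal (x i) 1)
        {y | ∑ i, x i ^ 4 + 6 * n * P + 3 * n + C * r ^ 3 ≤ ∑ i, y i ^ 4} ≤
          ENNReal.ofReal (1 / 8) := by
  set m := ∫ z, z ^ 8 ∂(gaussianReal 0 1) with hm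
  have hm0 : 0 ≤ m := integral_nonneg fun z => by positivity
  refine ⟨√(2176 * (8 * P ^ 3 + m)), by positivity, fun n r hr hrn x hx2 hx4 => ?_⟩
  have hmem : ∀ i, MemLp (fun y => y ^ 4) 2 (gaussianReal (x i) 1) := fun i => by
    convert memLp_two_polynomial_gaussianReal (x i) 1 (Polynomial.X ^ 4) using 2 with y
    simp
  have hmean : ∀ i, ∫ y, y ^ 4 ∂(gaussianReal (x i) 1) = x i ^ 4 + 6 * x i ^ 2 + 3 := fun i => by
    rw [integral_gaussianReal_eq_shift (x i) (by fun_prop)]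
    convert integral_quartic_gaussianReal (x i ^ 4) (4 * x i ^ 3) (6 * x i ^ 2) (4 * x i) 1 using 2
    · ext z; ring
    · ring
  have i2 := integrable_pow_gaussianReal 0 1 2
  have i8 := integrable_pow_gaussianReal 0 1 8
  have hvar : ∀ i, Var[fun y => y ^ 4; gaussianReal (x i) 1] ≤ 272 * (x i ^ 6 + m) := fun i => by
    refine (variance_gaussianReal_le (x i) (x i ^ 4) (by fun_prop)
      (((i2.const_mul _).add i8).const_mul 272) fun z =>
      sq_shift_pow_four_sub_le (x i) z).trans (le_of_eq ?_)
    simp only [Pi.add_apply]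
    rw [integral_const_mul, integral_add (i2.const_mul _) i8, integral_const_mul,
      integral_sq_gaussianReal]
    simp [hm]
  have hr2 : (n : ℝ) ≤ r ^ 6 := by
    rw [← hrn]; exact pow_le_pow_right₀ hr (by norm_num)
  have h6 : ∑ i, x i ^ 6 ≤ 8 * P ^ 3 * r ^ 6 := by
    refine (sum_pow_six_le x (t := 2 * P * r ^ 2) (by positivity) ?_).trans (le_of_eq (by ring))
    refine hx4.trans ?_
    rw [← hrn]
    nlinarith [show 0 ≤ P ^ 2 * r ^ 4 by positivity]
  refine pi_sum_ge_le (fun i => gaussianReal (x i) 1) hmem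
    (m := ∑ i, x i ^ 4 + 6 * n * P + 3 * n) (v := 272 * (8 * P ^ 3 + m) * r ^ 6)
    (s := √(2176 * (8 * P ^ 3 + m)) * r ^ 3) ?_ ?_ (by positivity) ?_
  · simp_rw [hmean]
    rw [Finset.sum_add_distrib, Finset.sum_add_distrib, ← Finset.mul_sum]
    simp only [Finset.sum_const, Finset.card_univ, Fintype.card_fin, nsmul_eq_mul]
    linarith
  · refine (Finset.sum_le_sum fun i _ => hvar i).trans ?_
    rw [← Finset.mul_sum, Finset.sum_add_distrib]
    simp only [Finset.sum_const, Finset.card_univ, Fintype.card_fin, nsmul_eq_mul]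
    nlinarith
  · rw [mul_pow, Real.sq_sqrt (by positivity)]
    exact le_of_eq (by ring)

/-! ### The weighted converse for codes. -/

lemma awgn_eq_map_pi (P : ℝ) (n : ℕ) (x : AwgnInput P n) :
    awgn P n x = (Measure.pi fun i => gaussianReal (x.1 i) 1).map (WithLp.toLp 2) := by
  change multivariateGaussian x.1 1 = _
  rw [multivariateGaussian_one_eq_map, ← map_pi_eq_stdGaussian,
    Measure.map_map (by fun_prop) (by fun_prop)]
  have h : (Measure.pi fun i => gaussianReal (x.1 i) 1) =
      (Measure.pi fun _ : Fin n => gaussianReal 0 1).map (fun z i => x.1 i + z i) := by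
    rw [Measure.pi_map_pi (fun _ => by fun_prop)]
    simp [gaussianReal_map_const_add]
  rw [h, Measure.map_map (by fun_prop) (by fun_prop)]
  rfl

lemma AwgnInput.sum_sq_le {P : ℝ} (hP : 0 ≤ P) {n : ℕ} (x : AwgnInput P n) :
    ∑ i, x.1 i ^ 2 ≤ n * P := by
  rw [← EuclideanSpace.real_norm_sq_eq]
  exact (pow_le_pow_left₀ (norm_nonneg _) x.2 2).trans_eq (Real.sq_sqrt (by positivity))

/-- The budget is `1 - 1/2 - 1/4`: decoding error and atypical outputs are removed. -/
lemma MaxDetCode.quarter_le_setLIntegral {P ε : ℝ} (hε : ε < 1 / 2) {n M : ℕ}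
    (c : MaxDetCode (awgn P n) M ε) (j : Fin M) {G : Set (Fin n → ℝ)} (hG : MeasurableSet G)
    (h : Measure.pi (fun i => gaussianReal ((c.encoder j).1 i) 1) Gᶜ ≤ ENNReal.ofReal (1 / 4)) :
    ENNReal.ofReal (1 / 4) ≤ ∫⁻ y in G, c.decoder (WithLp.toLp 2 y) {j}
      ∂(Measure.pi fun i => gaussianReal ((c.encoder j).1 i) 1) := by
  have := c.isMarkovKernel_decoder
  set μ := Measure.pi fun i => gaussianReal ((c.encoder j).1 i) 1 with hμ
  have hmeas : ∀ s : Set (Fin M), Measurable fun y : Fin n → ℝ => c.decoder (WithLp.toLp 2 y) s :=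
    fun s => (c.decoder.measurable_coe (Set.toFinite s).measurableSet).comp (by fun_prop)
  have he : ∫⁻ y, c.decoder (WithLp.toLp 2 y) {j}ᶜ ∂μ ≤ ENNReal.ofReal (1 / 2) := by
    refine le_trans (le_of_eq ?_) ((c.error_le j).trans (ENNReal.ofReal_le_ofReal hε.le))
    rw [Kernel.comp_apply' _ _ _ (Set.toFinite _).measurableSet, awgn_eq_map_pi,
      lintegral_map (c.decoder.measurable_coe (Set.toFinite _).measurableSet) (by fun_prop)]
  have h1 : (1 : ℝ≥0∞) ≤ (∫⁻ y in G, c.decoder (WithLp.toLp 2 y) {j} ∂μ) +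
      (ENNReal.ofReal (1 / 2) + ENNReal.ofReal (1 / 4)) := by
    calc (1 : ℝ≥0∞) = μ G + μ Gᶜ := by rw [prob_add_prob_compl hG]
      _ = (∫⁻ y in G, (c.decoder (WithLp.toLp 2 y) {j} + c.decoder (WithLp.toLp 2 y) {j}ᶜ) ∂μ) +
          μ Gᶜ := by
        congr 1
        simp_rw [prob_add_prob_compl (Set.toFinite {j}).measurableSet]
        simp
      _ ≤ _ := by
        rw [lintegral_add_left (hmeas _), add_assoc]
        gcongr
        exact (setLIntegral_le_lintegral _ _).trans he
  have h2 : (1 : ℝ≥0∞) = ENNReal.ofReal (1 / 4) +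
      (ENNReal.ofReal (1 / 2) + ENNReal.ofReal (1 / 4)) := by
    rw [← ENNReal.ofReal_add (by norm_num) (by norm_num),
      ← ENNReal.ofReal_add (by norm_num) (by norm_num)]
    norm_num
  rw [h2] at h1
  exact (ENNReal.add_le_add_iff_right (by simp)).1 h1

/-- Weighted converse for the AWGN channel: exponential weights `w j` that are dominated by `W` with
high probability under the codeword `j` sum to at most `exp (n C + K √n)` times the exponential
moment of `W` under the capacity-achieving output distribution. -/
lemma exists_weighted_converse {P : ℝ} (hP : 0 < P) : ∃ K : ℝ, 0 < K ∧
    ∀ (ε : ℝ), ε < 1 / 2 → ∀ (n M : ℕ), 1 ≤ n → ∀ (c : MaxDetCode (awgn P n) M ε)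
      (S : Finset (Fin M)) (E : Fin M → Set (Fin n → ℝ)) (w : Fin M → ℝ) (W : (Fin n → ℝ) → ℝ),
      (∀ j, MeasurableSet (E j)) → Measurable W →
      (∀ j ∈ S, Measure.pi (fun i => gaussianReal ((c.encoder j).1 i) 1) (E j) ≤
        ENNReal.ofReal (1 / 8)) →
      (∀ j ∈ S, ∀ y ∉ E j, w j ≤ W y) →
      ENNReal.ofReal (∑ j ∈ S, Real.exp (w j)) ≤
        ENNReal.ofReal (Real.exp (n / 2 * Real.log (1 + P) + K * √n)) *
          ∫⁻ y, ENNReal.ofReal (Real.exp (W y))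
            ∂(Measure.pi fun _ : Fin n => gaussianReal 0 (1 + P).toNNReal) := by
  -- The extra `2` absorbs the factor `4` from the decoder mass, since `4 ≤ exp 2 ≤ exp (2√n)`.
  refine ⟨√(8 * (2 * P + 3)) + 2, by positivity,
    fun ε hε n M hn c S E w W hE hW hE' hw => ?_⟩
  set v := (1 + P).toNNReal with hv
  have hvP : (v : ℝ) = 1 + P := Real.coe_toNNReal _ (by linarith)
  have hv0 : v ≠ 0 := by
    intro h; rw [h] at hvP; simp at hvP; linarith
  set Q := Measure.pi fun _ : Fin n => gaussianReal 0 v with hQ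
  set φ : Fin M → Fin n → ℝ → ℝ := fun j i y =>
    y ^ 2 / (2 * v) - (y - (c.encoder j).1 i) ^ 2 / 2 with hφ
  set f : Fin M → (Fin n → ℝ) → ℝ≥0∞ := fun j y =>
    ∏ i, ENNReal.ofReal (√v * Real.exp (φ j i (y i))) with hf
  have hφm : ∀ j i, Measurable (φ j i) := fun j i => by fun_prop
  have hPj : ∀ j, Measure.pi (fun i => gaussianReal ((c.encoder j).1 i) 1) =
      Q.withDensity (f j) := fun j => by
    have he : ∀ i, gaussianReal ((c.encoder j).1 i) 1 = (gaussianReal 0 v).withDensity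
        (fun y => ENNReal.ofReal (√v * Real.exp (φ j i y))) := fun i =>
      gaussianReal_one_eq_withDensity _ hv0
    have hprob : ∀ i, IsProbabilityMeasure ((gaussianReal 0 v).withDensity
        (fun y => ENNReal.ofReal (√v * Real.exp (φ j i y)))) := fun i => by
      rw [← he i]; infer_instance
    simp_rw [he]
    exact pi_withDensity (fun _ => gaussianReal 0 v) _ fun i => by
      have := hφm j i
      fun_prop
  set L : Fin M → Set (Fin n → ℝ) := fun j =>
    {y | √(8 * (2 * P + 3)) * √n ≤ ∑ i, φ j i (y i)} with hL
  have hLm : ∀ j, MeasurableSet (L j) := fun j =>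
    measurableSet_le (by fun_prop) (by fun_prop)
  set γ : ℝ := n / 2 * Real.log (1 + P) + √(8 * (2 * P + 3)) * √n with hγ
  have hfγ : ∀ j, ∀ y ∉ L j, f j y ≤ ENNReal.ofReal (Real.exp γ) := by
    intro j y hy
    simp only [hL, Set.mem_ofPred_eq, not_le] at hy
    rw [hf]
    simp only
    rw [← ENNReal.ofReal_prod_of_nonneg fun _ _ => by positivity]
    refine ENNReal.ofReal_le_ofReal ?_
    rw [Finset.prod_mul_distrib, ← Real.exp_sum, Finset.prod_const, Finset.card_univ,
      Fintype.card_fin, hγ, Real.exp_add]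
    have hsq : √(v : ℝ) ^ n = Real.exp (n / 2 * Real.log (1 + P)) := by
      rw [hvP, ← Real.exp_log (Real.sqrt_pos.2 (by linarith : 0 < 1 + P)), ← Real.exp_nat_mul,
        Real.log_sqrt (by linarith)]
      congr 1; ring
    rw [hsq]
    gcongr
  have main := mul_sum_le_of_good_sets Q (f := f)
    (D := fun j y => c.decoder (WithLp.toLp 2 y) {j}) (G := fun j => (L j ∪ E j)ᶜ)
    (w := fun j => ENNReal.ofReal (Real.exp (w j))) (W := fun y => ENNReal.ofReal (Real.exp (W y)))
    (Γ := ENNReal.ofReal (Real.exp γ)) (a := ENNReal.ofReal (1 / 4))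
    (fun j => by
      have := hφm j
      fun_prop)
    (fun j => (c.decoder.measurable_coe (Set.toFinite _).measurableSet).comp (by fun_prop)) ?_
    (fun j => ((hLm j).union (hE j)).compl) (by fun_prop) S ?_ ?_ ?_
  · rw [← ENNReal.ofReal_sum_of_nonneg fun _ _ => (Real.exp_pos _).le] at main
    have h4 : 4 * Real.exp γ ≤ Real.exp (n / 2 * Real.log (1 + P) +
        (√(8 * (2 * P + 3)) + 2) * √n) := by
      have h1 : 1 ≤ √(n : ℝ) := Real.one_le_sqrt.2 (by exact_mod_cast hn)
      have h2 : (4 : ℝ) ≤ Real.exp 2 := by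
        have := Real.exp_one_gt_d9
        rw [show (2 : ℝ) = 1 + 1 by norm_num, Real.exp_add]; nlinarith
      calc 4 * Real.exp γ ≤ Real.exp (2 * √n) * Real.exp γ := by
            gcongr
            exact h2.trans (Real.exp_le_exp.2 (by linarith))
        _ = _ := by rw [← Real.exp_add, hγ]; congr 1; ring
    calc ENNReal.ofReal (∑ j ∈ S, Real.exp (w j))
        = ENNReal.ofReal 4 * (ENNReal.ofReal (1 / 4) *
            ENNReal.ofReal (∑ j ∈ S, Real.exp (w j))) := by
          rw [← mul_assoc, ← ENNReal.ofReal_mul (by norm_num)]; norm_num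
      _ ≤ ENNReal.ofReal 4 * (ENNReal.ofReal (Real.exp γ) *
            ∫⁻ y, ENNReal.ofReal (Real.exp (W y)) ∂Q) := by gcongr
      _ ≤ _ := by
          rw [← mul_assoc, ← ENNReal.ofReal_mul (by norm_num)]
          gcongr
  · intro y
    have := c.isMarkovKernel_decoder
    simp
  · intro j hj
    rw [← hPj j]
    refine c.quarter_le_setLIntegral hε j ((hLm j).union (hE j)).compl ?_
    rw [compl_compl]
    refine (measure_union_le _ _).trans ?_
    have h8 : ENNReal.ofReal (1 / 4) = ENNReal.ofReal (1 / 8) + ENNReal.ofReal (1 / 8) := by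
      rw [← ENNReal.ofReal_add (by norm_num) (by norm_num)]; norm_num
    rw [h8]
    refine add_le_add ?_ (hE' j hj)
    have := pi_gaussian_infoDensity_tail hn hP (fun i => (c.encoder j).1 i)
      ((c.encoder j).sum_sq_le hP.le)
    simpa only [hL, hφ, hvP] using this
  · intro j _ y hy
    exact hfγ j y fun h => hy (Or.inl h)
  · intro j hj y hy
    exact ENNReal.ofReal_le_ofReal (Real.exp_le_exp.2 (hw j hj y fun h => hy (Or.inr h)))

/-! ### The `ℓ⁴` norm, uniform averages and Jensen's inequality. -/

lemma l4Norm_sq {n : ℕ} (x : EuclideanSpace ℝ (Fin n)) : l4Norm x ^ 2 = √(∑ i, x i ^ 4) := by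
  have h : ∀ i, |x i| ^ 4 = x i ^ 4 := fun i => Even.pow_abs (by decide) _
  rw [l4Norm, Real.sqrt_eq_rpow, ← Real.rpow_natCast, ← Real.rpow_mul]
  · simp_rw [h]; norm_num
  · positivity

lemma l4Norm_pow_four {n : ℕ} (x : EuclideanSpace ℝ (Fin n)) : l4Norm x ^ 4 = ∑ i, x i ^ 4 := by
  rw [show l4Norm x ^ 4 = (l4Norm x ^ 2) ^ 2 by ring, l4Norm_sq, Real.sq_sqrt]
  exact Finset.sum_nonneg fun i _ => by positivity

/-- A crude triangle inequality: `(a + b)⁴ ≤ 8 (a⁴ + b⁴)` and `√8 < 3`. -/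
lemma sqrt_sum_pow_four_le {n : ℕ} (x y : Fin n → ℝ) :
    √(∑ i, x i ^ 4) ≤ 3 * (√(∑ i, y i ^ 4) + √(∑ i, (y i - x i) ^ 4)) := by
  have hY : 0 ≤ ∑ i, y i ^ 4 := Finset.sum_nonneg fun i _ => by positivity
  have hZ : 0 ≤ ∑ i, (y i - x i) ^ 4 := Finset.sum_nonneg fun i _ => by positivity
  refine Real.sqrt_le_iff.2 ⟨by positivity, ?_⟩
  have h1 : ∑ i, x i ^ 4 ≤ 8 * (∑ i, y i ^ 4 + ∑ i, (y i - x i) ^ 4) := by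
    rw [← Finset.sum_add_distrib, Finset.mul_sum]
    refine Finset.sum_le_sum fun i _ => ?_
    have h2 : x i ^ 2 ≤ 2 * (y i ^ 2 + (y i - x i) ^ 2) := by
      nlinarith [sq_nonneg (2 * y i - x i)]
    have h3 : (x i ^ 2) ^ 2 ≤ (2 * (y i ^ 2 + (y i - x i) ^ 2)) ^ 2 :=
      pow_le_pow_left₀ (sq_nonneg _) h2 2
    nlinarith [sq_nonneg (y i ^ 2 - (y i - x i) ^ 2)]
  nlinarith [Real.sq_sqrt hY, Real.sq_sqrt hZ,
    mul_nonneg (Real.sqrt_nonneg (∑ i, y i ^ 4)) (Real.sqrt_nonneg (∑ i, (y i - x i) ^ 4))]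

lemma MaxDetCode.integral_inputDist {P ε : ℝ} {n M : ℕ} (c : MaxDetCode (awgn P n) M ε) :
    ∫ x, l4Norm x.1 ^ 4 ∂c.inputDist = (M : ℝ)⁻¹ * ∑ j, ∑ i, (c.encoder j).1 i ^ 4 := by
  simp_rw [l4Norm_pow_four]
  rw [MaxDetCode.inputDist, integral_map (measurable_of_finite _).aemeasurable, uniformOn,
    ProbabilityTheory.cond, Measure.restrict_univ, integral_smul_measure, integral_count]
  · simp [Measure.count_univ]
  · refine Measurable.aestronglyMeasurable ?_
    fun_prop

/-- Jensen's inequality, from the tangent line of `exp` at the mean. -/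
lemma card_mul_exp_mean_le_sum_exp {J : Type*} [Fintype J] [Nonempty J] (a : J → ℝ) :
    Fintype.card J * Real.exp ((Fintype.card J : ℝ)⁻¹ * ∑ j, a j) ≤ ∑ j, Real.exp (a j) := by
  set m := (Fintype.card J : ℝ)⁻¹ * ∑ j, a j with hm
  have hc : (Fintype.card J : ℝ) ≠ 0 := by exact_mod_cast Fintype.card_ne_zero
  have hs : ∑ j, (a j - m + 1) = Fintype.card J := by
    rw [Finset.sum_add_distrib, Finset.sum_sub_distrib]
    simp only [Finset.sum_const, Finset.card_univ, nsmul_eq_mul, hm]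
    field_simp
    ring
  calc Fintype.card J * Real.exp m = ∑ j, (a j - m + 1) * Real.exp m := by
        rw [← Finset.sum_mul, hs]
    _ ≤ ∑ j, Real.exp (a j - m) * Real.exp m := by
        gcongr; exact Real.add_one_le_exp _
    _ = ∑ j, Real.exp (a j) := by simp_rw [← Real.exp_add]; simp

/-! ### The two exponential sums over codewords. -/

lemma exists_sum_exp_l4Norm_sq_le {P : ℝ} (hP : 0 < P) : ∃ b : ℝ, 0 < b ∧ ∃ K : ℝ, 0 < K ∧
    ∀ (ε : ℝ), ε < 1 / 2 → ∀ (n M : ℕ), 1 ≤ n → ∀ c : MaxDetCode (awgn P n) M ε,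
      ∀ S : Finset (Fin M), ∑ j ∈ S, Real.exp (b * l4Norm (c.encoder j).1 ^ 2) ≤
        Real.exp (n / 2 * Real.log (1 + P) + K * √n) := by
  obtain ⟨K, hK, hconv⟩ := exists_weighted_converse hP
  obtain ⟨C, hC, htail⟩ := exists_pi_gaussian_noise_pow_four_tail
  obtain ⟨b, hb, A, hA, hmgf⟩ := exists_lintegral_exp_sqrt_add_pow_four_le (1 + P).toNNReal
  -- The `3` is the loss in the crude triangle inequality. The terms of the constant come from the
  -- converse, the moment `√(A + nA) ≤ 2A√n`, and the noise.
  refine ⟨b / 3, by positivity, K + 2 * b * A + b * √C, by positivity,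
    fun ε hε n M hn c S => ?_⟩
  have hn' : (1 : ℝ) ≤ n := by exact_mod_cast hn
  have h := hconv ε hε n M hn c S
    (fun j => {y | C * n ≤ ∑ i, (y i - (c.encoder j).1 i) ^ 4})
    (fun j => b / 3 * l4Norm (c.encoder j).1 ^ 2 - b * √C * √n)
    (fun y => b * √(A + ∑ i, y i ^ 4))
    (fun j => measurableSet_le (by fun_prop) (by fun_prop)) (by fun_prop)
    (fun j _ => htail n hn _) ?_
  · have hQ := lintegral_exp_sqrt_add_sum_pow_four_le (by linarith) hmgf n A le_rfl
    have h' := h.trans (mul_le_mul_right hQ _)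
    rw [← ENNReal.ofReal_mul (Real.exp_pos _).le, ← Real.exp_add,
      ENNReal.ofReal_le_ofReal_iff (Real.exp_pos _).le] at h'
    simp_rw [Real.exp_sub, ← Finset.sum_div] at h'
    rw [div_le_iff₀ (Real.exp_pos _), ← Real.exp_add] at h'
    refine h'.trans (Real.exp_le_exp.2 ?_)
    have : √(A + n * A) ≤ 2 * A * √n := by
      refine Real.sqrt_le_iff.2 ⟨by positivity, ?_⟩
      rw [mul_pow, Real.sq_sqrt (by positivity)]
      nlinarith [mul_le_mul hA hn' zero_le_one (by linarith)]
    nlinarith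
  · intro j _ y hy
    simp only [Set.mem_ofPred_eq, not_le] at hy
    rw [l4Norm_sq]
    have h1 := sqrt_sum_pow_four_le (fun i => (c.encoder j).1 i) y
    have h2 : √(∑ i, (y i - (c.encoder j).1 i) ^ 4) ≤ √C * √n := by
      rw [← Real.sqrt_mul hC.le]; exact Real.sqrt_le_sqrt hy.le
    have h3 : √(∑ i, y i ^ 4) ≤ √(A + ∑ i, y i ^ 4) := Real.sqrt_le_sqrt (by linarith)
    have h4 : √(∑ i, (c.encoder j).1 i ^ 4) ≤ 3 * (√(A + ∑ i, y i ^ 4) + √C * √n) := by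
      linarith
    nlinarith

/-- Concentration at scale `n^(3/4)` needs `‖x‖₄⁴ ≤ 3nP²`. The positive part gives every other
codeword weight one, so those are merely counted. -/
lemma exists_sum_exp_fourth_moment_gap_le {P l₀ : ℝ} (hP : 0 < P) (hl₀ : 0 < l₀) :
    ∃ K : ℝ, 0 < K ∧
    ∀ (ε : ℝ), ε < 1 / 2 → ∀ (n M : ℕ) (r : ℝ), 1 ≤ n → 1 ≤ r → r ^ 4 = n →
      ∀ c : MaxDetCode (awgn P n) M ε,
      ∑ j, Real.exp (l₀ / r * max (3 * n * P ^ 2 - ∑ i, (c.encoder j).1 i ^ 4) 0) ≤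
        Real.exp (n / 2 * Real.log (1 + P) + K * r ^ 2) := by
  obtain ⟨K, hK, hconv⟩ := exists_weighted_converse hP
  obtain ⟨C, hC, htail⟩ := exists_pi_gaussian_pow_four_tail hP
  set v := (1 + P).toNNReal with hv
  have hvP : (v : ℝ) = 1 + P := Real.coe_toNNReal _ (by linarith)
  set V := ∫ y, y ^ 8 ∂(gaussianReal 0 v) with hV
  have hV0 : 0 ≤ V := integral_nonneg fun z => by positivity
  -- With `l = l₀ / r`, both `l r³` and `l² n` are multiples of `r² = √n`. The final `1` pays for
  -- the factor `2` from adding the two classes of codewords.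
  refine ⟨K + l₀ * C + l₀ ^ 2 * V / 2 + 1, by positivity, fun ε hε n M r hn hr hrn c => ?_⟩
  have hsn : √(n : ℝ) = r ^ 2 := by
    rw [← hrn, show r ^ 4 = (r ^ 2) ^ 2 by ring, Real.sqrt_sq (by positivity)]
  have hr0 : 0 < r := by linarith
  set l := l₀ / r with hl
  have hlr : l * r = l₀ := by rw [hl]; field_simp
  have hl0 : 0 < l := by positivity
  set F : Fin M → ℝ := fun j => ∑ i, (c.encoder j).1 i ^ 4 with hF
  set γ := n / 2 * Real.log (1 + P) + K * √n with hγ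
  set S := Finset.univ.filter fun j => F j ≤ 3 * n * P ^ 2 with hS
  have h1 : ∑ j ∈ S, Real.exp (l * max (3 * n * P ^ 2 - F j) 0) ≤
      Real.exp (γ + (l₀ * C + l₀ ^ 2 * V / 2) * r ^ 2) := by
    have h := hconv ε hε n M hn c S
      (fun j => {y | F j + 6 * n * P + 3 * n + C * r ^ 3 ≤ ∑ i, y i ^ 4})
      (fun j => -l * (F j + 6 * n * P + 3 * n + C * r ^ 3))
      (fun y => -l * ∑ i, y i ^ 4)
      (fun j => measurableSet_le (by fun_prop) (by fun_prop)) (by fun_prop)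
      (fun j hj => htail n r hr hrn _ ((c.encoder j).sum_sq_le hP.le)
        (Finset.mem_filter.1 hj).2) ?_
    · have h' := h.trans (mul_le_mul_right (lintegral_exp_neg_sum_pow_four_le n v hl0.le) _)
      rw [← ENNReal.ofReal_mul (Real.exp_pos _).le, ← Real.exp_add,
        ENNReal.ofReal_le_ofReal_iff (Real.exp_pos _).le] at h'
      -- Multiplying through cancels the `Q`-mean; `3(1+P)² - 6P - 3 = 3P²` leaves exactly the gap.
      have h2 := mul_le_mul_of_nonneg_right h'
        (Real.exp_pos (l * (3 * n * (1 + P) ^ 2 + C * r ^ 3))).le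
      rw [Finset.sum_mul, ← Real.exp_add] at h2
      simp_rw [← Real.exp_add] at h2
      refine le_trans (le_of_eq ?_) (h2.trans (le_of_eq ?_))
      · refine Finset.sum_congr rfl fun j hj => ?_
        rw [max_eq_left (sub_nonneg.2 (Finset.mem_filter.1 hj).2)]
        congr 1; ring
      · congr 1
        rw [hvP, ← hγ, ← hV, ← hlr, ← hrn]
        ring
    · intro j _ y hy
      simp only [Set.mem_ofPred_eq, not_le] at hy
      nlinarith
  have h2 : ∑ j ∈ Finset.univ.filter (fun j => ¬ F j ≤ 3 * n * P ^ 2),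
      Real.exp (l * max (3 * n * P ^ 2 - F j) 0) ≤ Real.exp γ := by
    have h := hconv ε hε n M hn c (Finset.univ.filter fun j => ¬ F j ≤ 3 * n * P ^ 2)
      (fun _ => ∅) (fun _ => 0) (fun _ => 0) (fun _ => MeasurableSet.empty) measurable_const
      (fun _ _ => by simp) (fun _ _ _ _ => le_rfl)
    simp only [Real.exp_zero, ENNReal.ofReal_one, lintegral_const, measure_univ, mul_one] at h
    rw [ENNReal.ofReal_le_ofReal_iff (Real.exp_pos _).le] at h
    refine le_trans (le_of_eq (Finset.sum_congr rfl fun j hj => ?_)) h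
    have := (Finset.mem_filter.1 hj).2
    rw [max_eq_right (by linarith)]
    simp
  rw [← Finset.sum_filter_add_sum_filter_not Finset.univ fun j => F j ≤ 3 * n * P ^ 2]
  have h3 : Real.exp γ ≤ Real.exp (γ + (l₀ * C + l₀ ^ 2 * V / 2) * r ^ 2) :=
    Real.exp_le_exp.2 (le_add_of_nonneg_right (by positivity))
  calc _ ≤ 2 * Real.exp (γ + (l₀ * C + l₀ ^ 2 * V / 2) * r ^ 2) := by linarith
    _ ≤ Real.exp (r ^ 2) * Real.exp (γ + (l₀ * C + l₀ ^ 2 * V / 2) * r ^ 2) := by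
        gcongr
        have : 1 ≤ r ^ 2 := one_le_pow₀ hr
        linarith [Real.add_one_le_exp (r ^ 2)]
    _ = _ := by rw [← Real.exp_add, hγ, hsn]; congr 1; ring

/-! ### Conclusion, in logarithms to base `B`. -/

theorem mainTheorem12 (B : ℝ) (hB : 1 < B) (P ε : ℝ) (hP : 0 < P) (hε : 0 < ε) (hε' : ε < 1 / 2) :
    (∃ b₁ : ℝ, 0 < b₁ ∧ ∃ b₂ : ℝ, 0 < b₂ ∧ ∀ (n M : ℕ), 1 ≤ n → 1 ≤ M → ∀ c : MaxDetCode (awgn P n) M ε,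
      (M : ℝ) / 2 ≤ (Set.ncard {j : Fin M | l4Norm (c.encoder j).1 ^ 2 ≤
        2 / b₁ * (n * awgnCapacity B P + b₂ * √n - Real.logb B (M / 2))} : ℝ)) ∧
    (∃ b₃ : ℝ, 0 < b₃ ∧ ∀ (n M : ℕ), 1 ≤ n → 1 ≤ M → ∀ c : MaxDetCode (awgn P n) M ε,
      3 * n * P ^ 2 - (n * awgnCapacity B P - Real.logb B M + b₃ * √n) * (n : ℝ) ^ ((1 : ℝ) / 4) ≤
        ∫ x, l4Norm x.1 ^ 4 ∂c.inputDist) := by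
  have hlB : 0 < Real.log B := Real.log_pos hB
  constructor
  · obtain ⟨b, hb, K, hK, h⟩ := exists_sum_exp_l4Norm_sq_le hP
    -- Chosen so that `b * T` equals the natural-log exponent of the sum bound minus `log (M / 2)`;
    -- more than `M / 2` codewords above `T` would then violate that bound.
    refine ⟨2 * b / Real.log B, by positivity, K / Real.log B, by positivity,
      fun n M hn hM c => ?_⟩
    have hM' : (0 : ℝ) < M := by exact_mod_cast hM
    set T := 2 / (2 * b / Real.log B) *
      (n * awgnCapacity B P + K / Real.log B * √n - Real.logb B (M / 2)) with hT
    have hbT : b * T = n / 2 * Real.log (1 + P) + K * √n - Real.log (M / 2) := by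
      rw [hT, awgnCapacity, Real.logb, Real.logb]
      field_simp
    have hS := h ε hε' n M hn c (Finset.univ.filter fun j => ¬ l4Norm (c.encoder j).1 ^ 2 ≤ T)
    have hle : ((Finset.univ.filter fun j => ¬ l4Norm (c.encoder j).1 ^ 2 ≤ T).card : ℝ) ≤
        M / 2 := by
      have h1 : ((Finset.univ.filter fun j => ¬ l4Norm (c.encoder j).1 ^ 2 ≤ T).card : ℝ) *
          Real.exp (b * T) ≤ M / 2 * Real.exp (b * T) := by
        calc _ = ∑ j ∈ Finset.univ.filter fun j => ¬ l4Norm (c.encoder j).1 ^ 2 ≤ T,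
              Real.exp (b * T) := by rw [Finset.sum_const, nsmul_eq_mul]
          _ ≤ _ := (Finset.sum_le_sum fun j hj => Real.exp_le_exp.2
              (mul_le_mul_of_nonneg_left (not_le.1 (Finset.mem_filter.1 hj).2).le hb.le)).trans hS
          _ = Real.exp (Real.log (M / 2)) * Real.exp (b * T) := by
              rw [hbT, ← Real.exp_add]; congr 1; ring
          _ = _ := by rw [Real.exp_log (by positivity)]
      exact le_of_mul_le_mul_right h1 (Real.exp_pos _)
    have hcard : ((Finset.univ.filter fun j => l4Norm (c.encoder j).1 ^ 2 ≤ T).card : ℝ) +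
        (Finset.univ.filter fun j => ¬ l4Norm (c.encoder j).1 ^ 2 ≤ T).card = M := by
      rw [← Nat.cast_add, Finset.card_filter_add_card_filter_not]; simp
    have hncard : Set.ncard {j : Fin M | l4Norm (c.encoder j).1 ^ 2 ≤ T} =
        (Finset.univ.filter fun j => l4Norm (c.encoder j).1 ^ 2 ≤ T).card := by
      rw [← Set.ncard_coe_finset]; simp
    rw [hncard]
    linarith
  -- Taking `l₀ = log B` makes the coefficient of `n^(1/4)` exactly one in base `B`.
  · obtain ⟨K, hK, h⟩ := exists_sum_exp_fourth_moment_gap_le hP hlB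
    refine ⟨K / Real.log B, by positivity, fun n M hn hM c => ?_⟩
    have hM' : (0 : ℝ) < M := by exact_mod_cast hM
    have hn' : (1 : ℝ) ≤ n := by exact_mod_cast hn
    have : Nonempty (Fin M) := ⟨⟨0, hM⟩⟩
    rw [c.integral_inputDist]
    set r := (n : ℝ) ^ ((1 : ℝ) / 4) with hr
    have hr1 : 1 ≤ r := Real.one_le_rpow hn' (by norm_num)
    have hrn : r ^ 4 = n := by
      rw [hr, ← Real.rpow_natCast, ← Real.rpow_mul (by positivity)]; norm_num
    have hsn : √(n : ℝ) = r ^ 2 := by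
      rw [← hrn, show r ^ 4 = (r ^ 2) ^ 2 by ring, Real.sqrt_sq (by positivity)]
    have hr0 : 0 < r := by linarith
    set g : Fin M → ℝ := fun j => 3 * n * P ^ 2 - ∑ i, (c.encoder j).1 i ^ 4 with hg
    have h1 := (card_mul_exp_mean_le_sum_exp
      fun j => Real.log B / r * max (g j) 0).trans (h ε hε' n M r hn hr1 hrn c)
    rw [Fintype.card_fin] at h1
    have h2 := Real.log_le_log (by positivity) h1
    rw [Real.log_exp, Real.log_mul hM'.ne' (Real.exp_pos _).ne', Real.log_exp, ← Finset.mul_sum] at h2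
    have h3 : (M : ℝ)⁻¹ * ∑ j, g j ≤ (M : ℝ)⁻¹ * ∑ j, max (g j) 0 := by
      gcongr; exact le_max_left _ _
    have h4 : (M : ℝ)⁻¹ * ∑ j, g j =
        3 * n * P ^ 2 - (M : ℝ)⁻¹ * ∑ j, ∑ i, (c.encoder j).1 i ^ 4 := by
      rw [hg, Finset.sum_sub_distrib]
      simp only [Finset.sum_const, Finset.card_univ, Fintype.card_fin, nsmul_eq_mul]
      field_simp
    have h5 : (M : ℝ)⁻¹ * ∑ j, max (g j) 0 ≤
        (n / 2 * Real.log (1 + P) + K * r ^ 2 - Real.log M) * (r / Real.log B) := by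
      rw [← mul_div_assoc, le_div_iff₀ hlB]
      have h6 : (M : ℝ)⁻¹ * (∑ j, max (g j) 0) * Real.log B =
          (M : ℝ)⁻¹ * (Real.log B / r * ∑ j, max (g j) 0) * r := by field_simp
      rw [h6]
      gcongr
      linarith
    have h7 : (n * awgnCapacity B P - Real.logb B M + K / Real.log B * √n) * r =
        (n / 2 * Real.log (1 + P) + K * r ^ 2 - Real.log M) * (r / Real.log B) := by
      rw [hsn, awgnCapacity, Real.logb, Real.logb]
      field_simp
      ring
    linarith
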